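/- Let $\mathcal A$ be an alphabet with $d\ge 11$ letters and let $\mathbf v=v_0v_1v_2\cdots$ be an infinite sequence over $\mathcal A$. A factor of $\mathbf v$ is a word of the form $v_iv_{i+1}\cdots v_{j-1}$ with $0\le i\le j$. For a word $w$, write $|w|$ for its length and $|w|_a$ for the number of occurrences of the letter $a$ in $w$. The sequence $\mathbf v$ is balanced if $|u|_a-|w|_a\le 1$ for every letter $a\in\mathcal A$ and all factors $u,w$ of $\mathbf v$ with $|u|=|w|$. The exponent of a nonempty word $z$ is $\exp(z)=|z|/|u|$, where $u$ is the shortest nonempty word such that $z$ is a prefix of $u^\omega=uuu\cdots$, and the critical exponent of $\mathbf v$ is $$\mathrm E(\mathbf v)=\sup\{\exp(z): z \text{ is a nonempty factor of } \mathbf v\}\in[1,+\infty].$$ Suppose that $\mathbf v$ is balanced and that $\mathrm E(\mathbf v)=\frac{d-1}{d-2}$. Then every letter $a\in\mathcal A$ has a frequency $$\rho_a=\lim_{n\to\infty}\frac{|v_0v_1\cdots v_{n-1}|_a}{n}$$ in $\mathbf v$ (that is, the limit exists), and the maximum letter frequency $\rho=\max_{a\in\mathcal A}\rho_a$ satisfies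 $$\frac1{d-1}<\rho<\frac1{d-2}.$$ -/

import Mathlib

namespace InfWord

variable {α : Type*}

/-- The word `v i, v (i+1), …, v (i+n-1)` read in the sequence `v` at position `i`. -/
def window (v : ℕ → α) (i n : ℕ) : List α :=
  (List.range n).map fun k => v (i + k)

/-- `w` is a (possibly empty) factor of the infinite sequence `v`. -/
def IsFactor (v : ℕ → α) (w : List α) : Prop :=
  ∃ i n : ℕ, w = window v i n

/-- `v` is balanced: in two factors of equal length, the numbers of occurrences of each letter
differ by at most `1` (the pair is ordered, so this is a bound on the absolute difference). -/
def IsBalanced [DecidableEq α] (v : ℕ → α) : Prop :=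
  ∀ (a : α) (u w : List α), IsFactor v u → IsFactor v w → u.length = w.length →
    u.count a ≤ w.count a + 1

/-- `z` is a prefix of the periodic sequence `uuu⋯`, where `u` is a nonempty word. -/
def IsPrefixOfOmegaPower (z u : List α) : Prop :=
  u ≠ [] ∧ ∀ i < z.length, z[i]? = u[i % u.length]?

/-- The minimal period of a nonempty word `z`: the length of the shortest nonempty word `u`
such that `z` is a prefix of `uuu⋯`. -/
noncomputable def minPeriod (z : List α) : ℕ :=
  sInf {p : ℕ | ∃ u : List α, u.length = p ∧ IsPrefixOfOmegaPower z u}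

/-- The exponent of a nonempty word `z`: its length divided by its minimal period. -/
noncomputable def wordExp (z : List α) : ℝ :=
  (z.length : ℝ) / (minPeriod z : ℝ)

/-- The critical exponent of `v`: the supremum, possibly `+∞`, of the exponents of the
nonempty factors of `v`. -/
noncomputable def critExp (v : ℕ → α) : EReal :=
  ⨆ z ∈ {z : List α | z ≠ [] ∧ IsFactor v z}, (wordExp z : EReal)

/-- The letter `a` has frequency `r` in `v`. -/
def HasLetterFreq [DecidableEq α] (v : ℕ → α) (a : α) (r : ℝ) : Prop :=
  Filter.Tendsto (fun n : ℕ => ((window v 0 n).count a : ℝ) / (n : ℝ)) Filter.atTop (nhds r)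

end InfWord

/-! Put m = d - 2. The bound on the exponents says that a word of length n recurs only at distance
at least n * m. So any m consecutive letters are distinct and every frequency is at most 1/m.
Balance makes letter counts behave like those of a rotation. A letter fixed along an arithmetic
progression forces all frequencies to be rational, hence `v` eventually periodic, which the exponent
bound forbids (`not_const_on_progression`). Positive frequencies are therefore irrational, and both
final inequalities are strict. If all frequencies were below 1/(m+1), no letter would recur at
distance m, so any m + 1 consecutive letters would be distinct. With only m + 2 letters this is so
rigid that some letter fills a progression (`false_of_distinct`). -/

/-! ### Balanced integer sequences: density, discrepancy, rationality. -/

theorem balanced_tendsto (S : ℕ → ℤ) (h0 : S 0 = 0)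
    (hb : ∀ i j n, S (i + n) - S i ≤ S (j + n) - S j + 1) (hpos : ∀ n, 0 ≤ S n) :
    ∃ θ : ℝ, Filter.Tendsto (fun n : ℕ => (S n : ℝ) / n) Filter.atTop (nhds θ) := by
  -- Balance costs 1 per splitting, so adding 1 gives subadditivity and Fekete's lemma applies.
  have hsub : Subadditive fun n => ((S n : ℝ) + 1) := by
    intro m n
    have := hb m 0 n
    simp only [zero_add, h0] at this
    have h2 : (S (m + n) : ℝ) - S m ≤ S n - 0 + 1 := by exact_mod_cast this
    linarith
  have hbdd : BddBelow (Set.range fun n : ℕ => ((S n : ℝ) + 1) / n) := by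
    refine ⟨0, ?_⟩
    rintro _ ⟨n, rfl⟩
    have : (0 : ℝ) ≤ S n := by exact_mod_cast hpos n
    positivity
  refine ⟨hsub.lim, ?_⟩
  have h1 := (hsub.tendsto_lim hbdd).sub tendsto_one_div_atTop_nhds_zero_nat
  rw [sub_zero] at h1
  refine h1.congr fun n => ?_
  ring

/-- Cut a prefix into k blocks of length n: each has sum within 1 of the given block's sum, and k →
∞ transfers this to n * θ. -/
theorem balanced_discrepancy {S : ℕ → ℤ} (h0 : S 0 = 0)
    (hb : ∀ i j n, S (i + n) - S i ≤ S (j + n) - S j + 1) {θ : ℝ}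
    (hθ : Filter.Tendsto (fun n : ℕ => (S n : ℝ) / n) Filter.atTop (nhds θ)) (i n : ℕ) :
    |(S (i + n) : ℝ) - S i - n * θ| ≤ 1 := by
  rcases Nat.eq_zero_or_pos n with rfl | hn
  · simp
  have hn' : (0 : ℝ) < n := by exact_mod_cast hn
  set c : ℤ := S (i + n) - S i with hc
  have key : ∀ k : ℕ, k * (c - 1) ≤ S (n * k) ∧ S (n * k) ≤ k * (c + 1) := by
    intro k
    induction k with
    | zero => simp [h0]
    | succ k ih =>
      have h1 := hb i (n * k) n
      have h2 := hb (n * k) i n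
      rw [Nat.mul_succ]
      push_cast
      constructor <;> linarith [ih.1, ih.2]
  have hmul : Filter.Tendsto (fun k : ℕ => n * k) Filter.atTop Filter.atTop :=
    Filter.tendsto_id.const_mul_atTop' hn
  have h1 := hθ.comp hmul
  have lower : ((c : ℝ) - 1) / n ≤ θ := by
    refine ge_of_tendsto h1 ?_
    filter_upwards [Filter.eventually_gt_atTop 0] with k hk
    have hk' : (0 : ℝ) < k := by exact_mod_cast hk
    have : (k : ℝ) * (c - 1) ≤ S (n * k) := by exact_mod_cast (key k).1
    simp only [Function.comp, Nat.cast_mul]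
    rw [div_le_div_iff₀ hn' (by positivity)]
    nlinarith
  have upper : θ ≤ ((c : ℝ) + 1) / n := by
    refine le_of_tendsto h1 ?_
    filter_upwards [Filter.eventually_gt_atTop 0] with k hk
    have hk' : (0 : ℝ) < k := by exact_mod_cast hk
    have : (S (n * k) : ℝ) ≤ k * (c + 1) := by exact_mod_cast (key k).2
    simp only [Function.comp, Nat.cast_mul]
    rw [div_le_div_iff₀ (by positivity) hn']
    nlinarith
  rw [div_le_iff₀ hn'] at lower
  rw [le_div_iff₀ hn'] at upper
  have hcR : (c : ℝ) = S (i + n) - S i := by rw [hc]; push_cast; ring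
  rw [abs_le]
  constructor <;> linarith

/-- The increments of a prefix-count function with irrational density are not constant along an
arithmetic progression. -/
theorem not_irrational_of_const_increment {S : ℕ → ℤ} {θ : ℝ}
    (hD : ∀ i n : ℕ, |(S (i + n) : ℝ) - S i - n * θ| ≤ 1) {r P : ℕ} (hP : 0 < P) {b : ℤ}
    (hconst : ∀ j : ℕ, S (r + j * P + 1) - S (r + j * P) = b) : ¬ Irrational θ := by
  intro hirr
  set κ : ℝ := |(b : ℝ) - θ| with hκ
  have hκpos : 0 < κ := by
    rw [hκ, abs_pos, sub_ne_zero]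
    exact (hirr.ne_int b).symm
  set D : ℕ → ℝ := fun n => S n - n * θ with hDdef
  have hDD : ∀ i j, |D i - D j| ≤ 1 := by
    have : ∀ i n, |D (i + n) - D i| ≤ 1 := fun i n => by
      have := hD i n
      simp only [hDdef]
      push_cast
      convert this using 2
      ring
    intro i j
    rcases le_total i j with h | h
    · obtain ⟨n, rfl⟩ := Nat.exists_eq_add_of_le h
      rw [abs_sub_comm]; exact this i n
    · obtain ⟨n, rfl⟩ := Nat.exists_eq_add_of_le h
      exact this j n
  set E : ℕ → ℝ := fun j => D (r + j * P) with hE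
  have hstep : ∀ j, D (r + j * P + 1) = E j + (b - θ) := by
    intro j
    have : (S (r + j * P + 1) : ℝ) - S (r + j * P) = b := by exact_mod_cast hconst j
    simp only [hE, hDdef]
    push_cast at this ⊢
    linarith
  -- `D` oscillates by at most 1, and so does the union of the values of `E` with their translates
  -- by b - θ.
  have hEE : ∀ i j, |E i - E j| ≤ 1 - κ := by
    intro i j
    have h1 := hDD (r + i * P + 1) (r + j * P)
    have h2 := hDD (r + j * P + 1) (r + i * P)
    rw [hstep] at h1 h2
    change |E i + (b - θ) - E j| ≤ 1 at h1
    change |E j + (b - θ) - E i| ≤ 1 at h2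
    rw [abs_le] at h1 h2
    rcases abs_cases ((b : ℝ) - θ) with h | h <;> rw [hκ, h.1, abs_le] <;>
      constructor <;> linarith
  have hη : Irrational (P * θ) := hirr.natCast_mul hP.ne'
  obtain ⟨m, hm⟩ := exists_nat_one_div_lt hκpos
  obtain ⟨k, hk0, -, hk⟩ := Real.exists_nat_abs_mul_sub_round_le (P * θ) (Nat.succ_pos m)
  set τ : ℝ := k * (P * θ) - round (k * (P * θ)) with hτ
  have hτ0 : τ ≠ 0 := by
    rw [hτ, sub_ne_zero]
    exact (hη.natCast_mul hk0.ne').ne_int _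
  have hτκ : |τ| < κ := by
    refine lt_of_le_of_lt hk (lt_of_le_of_lt ?_ hm)
    apply one_div_le_one_div_of_le
    · positivity
    · push_cast; linarith
  -- By Dirichlet |τ| < κ, so the defect is an integer of absolute value below 1, hence zero.
  -- Iterating makes `E` drift without bound.
  have hshift : ∀ j, E (j + k) = E j - τ := by
    intro j
    have h1 := hEE (j + k) j
    have h2 : E (j + k) - E j + τ =
        ((S (r + (j + k) * P) - S (r + j * P) - round (k * (P * θ)) : ℤ) : ℝ) := by
      simp only [hE, hDdef, hτ]
      push_cast
      ring
    have h3 : |E (j + k) - E j + τ| < 1 := by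
      calc _ ≤ |E (j + k) - E j| + |τ| := abs_add_le _ _
        _ < 1 := by linarith
    rw [h2] at h3
    have h4 : S (r + (j + k) * P) - S (r + j * P) - round (k * (P * θ)) = 0 := by
      rw [← Int.abs_lt_one_iff]
      exact_mod_cast h3
    rw [h4] at h2
    push_cast at h2
    linarith
  have hiter : ∀ i : ℕ, E (i * k) = E 0 - i * τ := by
    intro i
    induction i with
    | zero => simp
    | succ i ih => rw [Nat.succ_mul, hshift, ih]; push_cast; ring
  obtain ⟨i, hi⟩ := exists_nat_gt (1 / |τ|)
  have h1 := hEE (i * k) 0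
  rw [hiter] at h1
  have h2 : |E 0 - i * τ - E 0| = i * |τ| := by
    rw [show E 0 - i * τ - E 0 = -(i * τ) by ring, abs_neg, abs_mul, Nat.abs_cast]
  rw [h2] at h1
  rw [div_lt_iff₀ (abs_pos.mpr hτ0)] at hi
  linarith

/-- The defects S (n + q) - S n - p never take both signs, by balance, and they telescope along each
class mod q to sums of absolute value at most 1. So each class contains at most one nonzero defect.
-/
theorem eventually_periodic_of_rational {S : ℕ → ℤ}
    (hb : ∀ i j n, S (i + n) - S i ≤ S (j + n) - S j + 1) {p : ℤ} {q : ℕ} (hq : 0 < q)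
    (hD : ∀ i n : ℕ, |(S (i + n) : ℝ) - S i - n * ((p : ℝ) / q)| ≤ 1) :
    ∃ N, ∀ n, N ≤ n → S (n + q) - S n = p := by
  have hq' : (q : ℝ) ≠ 0 := by exact_mod_cast hq.ne'
  have hD' : ∀ n k : ℕ, |S (n + k * q) - S n - k * p| ≤ 1 := by
    intro n k
    have h := hD n (k * q)
    have : ((k * q : ℕ) : ℝ) * ((p : ℝ) / q) = k * p := by push_cast; field_simp
    rw [this] at h
    exact_mod_cast h
  set f : ℕ → ℤ := fun n => S (n + q) - S n - p with hf
  have hff : ∀ i j, f i ≤ f j + 1 := fun i j => by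
    have := hb i j q
    simp only [hf]; linarith
  have hsum : ∀ n k : ℕ, ∑ i ∈ Finset.range k, f (n + i * q) = S (n + k * q) - S n - k * p := by
    intro n k
    induction k with
    | zero => simp
    | succ k ih =>
      rw [Finset.sum_range_succ, ih]
      simp only [hf]
      rw [show n + (k + 1) * q = n + k * q + q by ring]
      push_cast; ring
  have hsign : ∃ ε : ℤ, (ε = 1 ∨ ε = -1) ∧ ∀ n, 0 ≤ ε * f n := by
    by_cases h : ∃ n, f n < 0
    · obtain ⟨n, hn⟩ := h
      refine ⟨-1, Or.inr rfl, fun m => ?_⟩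
      have := hff m n
      linarith
    · push Not at h
      exact ⟨1, Or.inl rfl, fun n => by simpa using h n⟩
  obtain ⟨ε, hε, hnn⟩ := hsign
  have hinj : Set.InjOn (fun n => n % q) {n | f n ≠ 0} := by
    have key : ∀ n m, n < m → f n ≠ 0 → f m ≠ 0 → n % q = m % q → False := by
      intro n m hnm hn hm hmod
      obtain ⟨k, hk⟩ : q ∣ m - n := (Nat.modEq_iff_dvd' hnm.le).mp hmod
      have hmk : m = n + k * q := by rw [mul_comm, ← hk]; omega
      have hk0 : k ≠ 0 := by rintro rfl; simp at hmk; omega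
      have hp : ∀ x, f x ≠ 0 → 1 ≤ ε * f x := by
        intro x hx
        have h0 : ε * f x ≠ 0 := mul_ne_zero (by rcases hε with h | h <;> simp [h]) hx
        have := hnn x
        omega
      have h1 : ε * ∑ i ∈ Finset.range (k + 1), f (n + i * q) ≤ 1 := by
        rw [hsum]
        have := abs_le.mp (hD' n (k + 1))
        rcases hε with h | h <;> rw [h] <;> linarith [this.1, this.2]
      rw [Finset.sum_range_succ, mul_add, ← hmk, Finset.mul_sum] at h1
      have h2 : ε * f (n + 0 * q) ≤ ∑ i ∈ Finset.range k, ε * f (n + i * q) :=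
        Finset.single_le_sum (f := fun i => ε * f (n + i * q)) (fun i _ => hnn _)
          (Finset.mem_range.mpr (Nat.pos_of_ne_zero hk0))
      rw [zero_mul, add_zero] at h2
      have := hp n hn
      have := hp m hm
      linarith
    intro n hn m hm h
    rcases lt_trichotomy n m with h' | h' | h'
    · exact (key n m h' hn hm h).elim
    · exact h'
    · exact (key m n h' hm hn h.symm).elim
  have hfin : {n | f n ≠ 0}.Finite :=
    Set.Finite.of_injOn (t := Set.Iio q) (fun n _ => Nat.mod_lt n hq) hinj (Set.finite_Iio q)
  obtain ⟨N, hN⟩ := hfin.bddAbove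
  refine ⟨N + 1, fun n hn => ?_⟩
  by_contra hne
  have : n ≤ N := hN (show f n ≠ 0 from fun h => hne (by simp only [hf] at h; linarith))
  omega
-- Exponents and repetitions.
namespace InfWord

variable {α : Type*}

theorem length_window (v : ℕ → α) (i n : ℕ) : (window v i n).length = n := by
  simp [window]

theorem window_add (v : ℕ → α) (i m n : ℕ) :
    window v i (m + n) = window v i m ++ window v (i + m) n := by
  simp [window, List.range_add, Function.comp_def, add_assoc]

theorem window_one (v : ℕ → α) (i : ℕ) : window v i 1 = [v i] := by
  simp [window]

theorem isFactor_window (v : ℕ → α) (i n : ℕ) : IsFactor v (window v i n) := ⟨i, n, rfl⟩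

theorem minPeriod_le_of_period {v : ℕ → α} {i p n : ℕ} (hp : 0 < p)
    (h : ∀ t < n, v (i + t) = v (i + p + t)) : minPeriod (window v i (p + n)) ≤ p := by
  refine Nat.sInf_le ⟨window v i p, length_window v i p, ?_, ?_⟩
  · intro h0
    have := length_window v i p
    rw [h0] at this
    simp at this
    omega
  · intro k hk
    rw [length_window] at hk ⊢
    have key : ∀ k, k < p + n → v (i + k) = v (i + k % p) := by
      intro k
      induction k using Nat.strong_induction_on with
      | _ k ih =>
        intro hk
        rcases lt_or_ge k p with hkp | hkp
        · rw [Nat.mod_eq_of_lt hkp]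
        · have h1 := h (k - p) (by omega)
          rw [show i + p + (k - p) = i + k by omega] at h1
          rw [← h1, ih (k - p) (by omega) (by omega), Nat.mod_eq_sub_mod hkp]
    have hmod : k % p < p := Nat.mod_lt k hp
    simp [window, hk, hmod, key k hk]

theorem minPeriod_pos {z : List α} (hz : z ≠ []) : 0 < minPeriod z := by
  have hne : {p : ℕ | ∃ u : List α, u.length = p ∧ IsPrefixOfOmegaPower z u}.Nonempty :=
    ⟨z.length, z, rfl, hz, fun i hi => by rw [Nat.mod_eq_of_lt hi]⟩
  obtain ⟨u, hu, hu0, -⟩ := Nat.sInf_mem hne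
  rw [minPeriod, ← hu]
  exact List.length_pos_iff.mpr hu0

/-- In a sequence of critical exponent at most `(d-1)/(d-2)`, a word of length `n` recurs only at
distance at least `n(d-2)`. -/
theorem mul_le_of_repetition {v : ℕ → α} {d : ℕ} (hd : 3 ≤ d)
    (hE : critExp v ≤ ((((d : ℝ) - 1) / ((d : ℝ) - 2) : ℝ) : EReal)) {i p n : ℕ} (hp : 0 < p)
    (h : ∀ t < n, v (i + t) = v (i + p + t)) : n * (d - 2) ≤ p := by
  have hz : window v i (p + n) ≠ [] := by
    rw [← List.length_pos_iff, length_window]; omega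
  have h1 : ((wordExp (window v i (p + n)) : ℝ) : EReal) ≤ critExp v :=
    le_iSup₂_of_le (window v i (p + n)) ⟨hz, isFactor_window v i _⟩ le_rfl
  have h2 : wordExp (window v i (p + n)) ≤ ((d : ℝ) - 1) / ((d : ℝ) - 2) := by
    exact_mod_cast h1.trans hE
  have hmp : (minPeriod (window v i (p + n)) : ℝ) ≤ p := by
    exact_mod_cast minPeriod_le_of_period hp h
  have hmpos : (0 : ℝ) < minPeriod (window v i (p + n)) := by exact_mod_cast minPeriod_pos hz
  have hd' : (3 : ℝ) ≤ d := by exact_mod_cast hd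
  have hp' : (0 : ℝ) < p := by exact_mod_cast hp
  have h3 : ((p : ℝ) + n) / p ≤ wordExp (window v i (p + n)) := by
    rw [wordExp, length_window]
    push_cast
    exact div_le_div_of_nonneg_left (by positivity) hmpos hmp
  have h4 := h3.trans h2
  rw [div_le_div_iff₀ hp' (by linarith)] at h4
  have h5 : ((n * (d - 2) : ℕ) : ℝ) ≤ p := by
    rw [Nat.cast_mul, Nat.cast_sub (by omega)]
    push_cast
    nlinarith
  exact_mod_cast h5

theorem not_eventually_periodic {v : ℕ → α} {d : ℕ} (hd : 4 ≤ d)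
    (hE : critExp v ≤ ((((d : ℝ) - 1) / ((d : ℝ) - 2) : ℝ) : EReal)) {N q : ℕ} (hq : 0 < q)
    (h : ∀ n, N ≤ n → v (n + q) = v n) : False := by
  have := mul_le_of_repetition (by omega) hE (i := N) (n := q) hq (fun t _ => by
    rw [← h (N + t) (by omega)]; congr 1; ring)
  have : q * 2 ≤ q * (d - 2) := Nat.mul_le_mul_left q (by omega)
  omega

/-! ### Letter frequencies and their irrationality. -/

section Count

variable [DecidableEq α]

/-- The number of occurrences of `a` before position `n`. -/
def prefixCount (v : ℕ → α) (a : α) (n : ℕ) : ℤ := ((window v 0 n).count a : ℤ)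

theorem prefixCount_zero (v : ℕ → α) (a : α) : prefixCount v a 0 = 0 := by
  simp [prefixCount, window]

theorem prefixCount_add (v : ℕ → α) (a : α) (i n : ℕ) :
    prefixCount v a (i + n) - prefixCount v a i = (window v i n).count a := by
  simp [prefixCount, window_add]

theorem prefixCount_succ_sub (v : ℕ → α) (a : α) (n : ℕ) :
    prefixCount v a (n + 1) - prefixCount v a n = if v n = a then 1 else 0 := by
  rw [prefixCount_add, window_one, List.count_singleton]
  simp

theorem prefixCount_balanced {v : ℕ → α} (hbal : IsBalanced v) (a : α) (i j n : ℕ) :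
    prefixCount v a (i + n) - prefixCount v a i ≤
      prefixCount v a (j + n) - prefixCount v a j + 1 := by
  rw [prefixCount_add, prefixCount_add]
  exact_mod_cast hbal a _ _ (isFactor_window v i n) (isFactor_window v j n)
    (by simp [length_window])

theorem exists_hasLetterFreq {v : ℕ → α} (hbal : IsBalanced v) (a : α) :
    ∃ θ, HasLetterFreq v a θ := by
  obtain ⟨θ, hθ⟩ := balanced_tendsto (prefixCount v a) (prefixCount_zero v a)
    (prefixCount_balanced hbal a) (fun n => by simp [prefixCount])
  exact ⟨θ, by simpa [HasLetterFreq, prefixCount] using hθ⟩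

theorem HasLetterFreq.discrepancy {v : ℕ → α} (hbal : IsBalanced v) {a : α} {θ : ℝ}
    (hθ : HasLetterFreq v a θ) (i n : ℕ) :
    |(prefixCount v a (i + n) : ℝ) - prefixCount v a i - n * θ| ≤ 1 :=
  balanced_discrepancy (prefixCount_zero v a) (prefixCount_balanced hbal a)
    (by simpa [HasLetterFreq, prefixCount] using hθ) i n

theorem HasLetterFreq.le_of_count_le {v : ℕ → α} {a : α} {θ : ℝ} (hbal : IsBalanced v)
    (hθ : HasLetterFreq v a θ) {n c : ℕ} (hn : 0 < n)
    (h : ∀ i, (window v i n).count a ≤ c) : θ ≤ (c : ℝ) / n := by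
  have hn' : (0 : ℝ) < n := by exact_mod_cast hn
  have hk : ∀ k : ℕ, prefixCount v a (k * n) ≤ k * c := by
    intro k
    induction k with
    | zero => simp [prefixCount_zero]
    | succ k ih =>
      have h1 := prefixCount_add v a (k * n) n
      have h2 : ((window v (k * n) n).count a : ℤ) ≤ c := by exact_mod_cast h _
      rw [Nat.succ_mul]
      push_cast
      linarith
  rw [le_div_iff₀ hn']
  by_contra! hlt
  obtain ⟨k, hk1⟩ := exists_nat_gt (1 / (θ * n - c))
  rw [div_lt_iff₀ (by linarith)] at hk1
  have h1 := abs_le.mp (hθ.discrepancy hbal 0 (k * n))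
  have h2 : (prefixCount v a (k * n) : ℝ) ≤ k * c := by exact_mod_cast hk k
  simp only [zero_add, prefixCount_zero] at h1
  push_cast at h1
  nlinarith [h1.1]

theorem HasLetterFreq.le_of_le_count {v : ℕ → α} {a : α} {θ : ℝ} (hbal : IsBalanced v)
    (hθ : HasLetterFreq v a θ) {n c : ℕ} (hn : 0 < n)
    (h : ∀ i, c ≤ (window v i n).count a) : (c : ℝ) / n ≤ θ := by
  have hn' : (0 : ℝ) < n := by exact_mod_cast hn
  have hk : ∀ k : ℕ, k * c ≤ prefixCount v a (k * n) := by
    intro k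
    induction k with
    | zero => simp [prefixCount_zero]
    | succ k ih =>
      have h1 := prefixCount_add v a (k * n) n
      have h2 : (c : ℤ) ≤ ((window v (k * n) n).count a : ℤ) := by exact_mod_cast h _
      rw [Nat.succ_mul]
      push_cast
      linarith
  rw [div_le_iff₀ hn']
  by_contra! hlt
  obtain ⟨k, hk1⟩ := exists_nat_gt (1 / (c - θ * n))
  rw [div_lt_iff₀ (by linarith)] at hk1
  have h1 := abs_le.mp (hθ.discrepancy hbal 0 (k * n))
  have h2 : (k * c : ℝ) ≤ prefixCount v a (k * n) := by exact_mod_cast hk k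
  simp only [zero_add, prefixCount_zero] at h1
  push_cast at h1
  nlinarith [h1.2]

/-- A letter of rational frequency has an eventually periodic set of occurrences. -/
theorem HasLetterFreq.eventually_periodic {v : ℕ → α} (hbal : IsBalanced v) {a : α} {θ : ℝ}
    (hθ : HasLetterFreq v a θ) (hrat : ¬ Irrational θ) :
    ∃ N q : ℕ, 0 < q ∧ ∀ n, N ≤ n → (v (n + q) = a ↔ v n = a) := by
  simp only [Irrational, not_not] at hrat
  obtain ⟨x, rfl⟩ := hrat
  have hD := hθ.discrepancy hbal
  rw [Rat.cast_def] at hD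
  obtain ⟨N, hN⟩ := eventually_periodic_of_rational (prefixCount_balanced hbal a) x.den_pos hD
  refine ⟨N, x.den, x.den_pos, fun n hn => ?_⟩
  have h1 := hN n hn
  have h2 := hN (n + 1) (by omega)
  have h3 := prefixCount_succ_sub v a n
  have h4 := prefixCount_succ_sub v a (n + x.den)
  rw [show n + 1 + x.den = n + x.den + 1 by ring] at h2
  by_cases ha : v n = a <;> by_cases hb : v (n + x.den) = a <;> simp [ha, hb] at h3 h4 ⊢ <;> omega

/-- Along the progression the indicator of every letter is constant, so every frequency is rational;
the product of the resulting periods is an eventual period of `v`. -/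
theorem not_const_on_progression [Finite α] {v : ℕ → α} (hbal : IsBalanced v) {d : ℕ} (hd : 4 ≤ d)
    (hE : critExp v ≤ ((((d : ℝ) - 1) / ((d : ℝ) - 2) : ℝ) : EReal)) {r P : ℕ} (hP : 0 < P)
    {y : α} (h : ∀ j : ℕ, v (r + j * P) = y) : False := by
  have hper : ∀ a : α, ∃ N q : ℕ, 0 < q ∧ ∀ n, N ≤ n → (v (n + q) = a ↔ v n = a) := by
    intro a
    obtain ⟨θ, hθ⟩ := exists_hasLetterFreq hbal a
    refine hθ.eventually_periodic hbal (not_irrational_of_const_increment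
      (b := if y = a then 1 else 0) (hθ.discrepancy hbal) hP (r := r) fun j => ?_)
    rw [prefixCount_succ_sub, h j]
  choose N q hq hN using hper
  have := Fintype.ofFinite α
  have hmul : ∀ a, ∀ k n, N a ≤ n → (v (n + k * q a) = a ↔ v n = a) := by
    intro a k n hn
    induction k with
    | zero => simp
    | succ k ih => rw [Nat.succ_mul, ← add_assoc, hN a _ (by omega), ih]
  refine not_eventually_periodic hd hE (N := ∑ a, N a) (q := ∏ a, q a)
    (Finset.prod_pos fun a _ => hq a) fun n hn => ?_
  obtain ⟨k, hk⟩ := Finset.dvd_prod_of_mem q (Finset.mem_univ (v n))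
  rw [hk, mul_comm]
  refine (hmul (v n) k n (le_trans ?_ hn)).mpr rfl
  exact Finset.single_le_sum (f := N) (fun _ _ => Nat.zero_le _) (Finset.mem_univ (v n))

theorem HasLetterFreq.irrational [Finite α] {v : ℕ → α} (hbal : IsBalanced v) {d : ℕ} (hd : 4 ≤ d)
    (hE : critExp v ≤ ((((d : ℝ) - 1) / ((d : ℝ) - 2) : ℝ) : EReal)) {a : α} {θ : ℝ}
    (hθ : HasLetterFreq v a θ) (hpos : 0 < θ) : Irrational θ := by
  by_contra hrat
  obtain ⟨N, q, hq, hN⟩ := hθ.eventually_periodic hbal hrat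
  have hocc : ∃ n, N ≤ n ∧ v n = a := by
    by_contra! hno
    have hc : ∀ n, prefixCount v a (N + n) = prefixCount v a N := by
      intro n
      induction n with
      | zero => rfl
      | succ n ih =>
        have := prefixCount_succ_sub v a (N + n)
        rw [if_neg (hno _ (by omega))] at this
        rw [← add_assoc]
        omega
    obtain ⟨n, hn⟩ := exists_nat_gt (1 / θ)
    rw [div_lt_iff₀ hpos] at hn
    have h1 := abs_le.mp (hθ.discrepancy hbal N n)
    rw [hc] at h1
    linarith [h1.1]
  obtain ⟨r, hr, hra⟩ := hocc
  refine not_const_on_progression hbal hd hE hq (r := r) (y := a) fun j => ?_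
  induction j with
  | zero => simpa using hra
  | succ j ih => rwa [Nat.succ_mul, ← add_assoc, hN _ (by omega)]

end Count

end InfWord
-- Sequences on m + 2 letters in which any m + 1 consecutive letters are distinct.
namespace InfWord

variable {α : Type*}

/-- The letters at positions `t` and `t + 1` are exchanged `m + 2` positions later. -/
def SwapAt (v : ℕ → α) (m t : ℕ) : Prop :=
  v (t + m + 2) = v (t + 1) ∧ v (t + m + 3) = v t

/-- The letter `x` recurs somewhere at distance `m + 1`. -/
def IsShort (v : ℕ → α) (m : ℕ) (x : α) : Prop :=
  ∃ n, v n = x ∧ v (n + m + 1) = x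

theorem exists_eq_of_distinct [Fintype α] {v : ℕ → α} {m : ℕ} (hcard : Fintype.card α = m + 2)
    (hdist : ∀ i j, i < j → j ≤ i + m → v i ≠ v j) {t : ℕ} (ht : v (t + m + 1) ≠ v t) (x : α) :
    ∃ j, t ≤ j ∧ j ≤ t + m + 1 ∧ v j = x := by
  have hne : ∀ i j, i < j → j < m + 2 → v (t + i) ≠ v (t + j) := by
    intro i j hij hj
    by_cases h : j ≤ i + m
    · exact hdist _ _ (by omega) (by omega)
    · obtain rfl : i = 0 := by omega
      obtain rfl : j = m + 1 := by omega
      exact ht.symm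
  have hinj : Function.Injective fun i : Fin (m + 2) => v (t + i) := by
    intro i j hij
    rcases lt_trichotomy (i : ℕ) j with h | h | h
    · exact (hne _ _ h j.2 hij).elim
    · exact Fin.ext h
    · exact (hne _ _ h i.2 hij.symm).elim
  obtain ⟨i, hi⟩ := ((Fintype.bijective_iff_injective_and_card _).mpr
    ⟨hinj, by simp [hcard]⟩).surjective x
  exact ⟨t + i, by omega, by omega, hi⟩

/-- Otherwise 2m ≤ m + 2, contrary to m ≥ 3. -/
theorem not_repeat_pair {v : ℕ → α} {m : ℕ} (hm : 3 ≤ m)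
    (hrep : ∀ i p n, 0 < p → (∀ t < n, v (i + t) = v (i + p + t)) → n * m ≤ p) {t p : ℕ}
    (hp : 0 < p) (hpm : p ≤ m + 2) (h0 : v t = v (t + p)) : v (t + 1) ≠ v (t + p + 1) := by
  intro h1
  have := hrep t p 2 hp (fun k hk => by
    interval_cases k
    · exact h0
    · exact h1)
  omega

theorem swapAt_of_eq [Fintype α] {v : ℕ → α} {m : ℕ} (hm : 3 ≤ m)
    (hcard : Fintype.card α = m + 2) (hdist : ∀ i j, i < j → j ≤ i + m → v i ≠ v j)
    (hrep : ∀ i p n, 0 < p → (∀ t < n, v (i + t) = v (i + p + t)) → n * m ≤ p) {t : ℕ}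
    (ht : v (t + m + 2) = v (t + 1)) : SwapAt v m t := by
  refine ⟨ht, ?_⟩
  have h0 : v (t + m + 1) ≠ v t := fun h => by
    refine not_repeat_pair hm hrep (t := t) (p := m + 1) (by omega) (by omega) h.symm ?_
    rw [← ht]; rfl
  obtain ⟨j, hj1, hj2, hj⟩ := exists_eq_of_distinct hcard hdist h0 (v (t + m + 3))
  rcases Nat.lt_or_ge j (t + 3) with h | h
  · obtain rfl | rfl | rfl : j = t ∨ j = t + 1 ∨ j = t + 2 := by omega
    · exact hj.symm
    · rw [← ht] at hj
      exact (hdist _ _ (by omega) (by omega) hj).elim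
    · refine (not_repeat_pair hm hrep (t := t + 1) (p := m + 1) (by omega) (by omega) ?_ ?_).elim
      · rw [← ht]; congr 1; omega
      · rw [hj]; congr 1; omega
  · exact (hdist _ _ (by omega) (by omega) hj).elim

/-- The letter at t + 1 either recurs at distance m + 2 ("stays") or is exchanged with its right or
left neighbour. -/
theorem stay_or_swapAt [Fintype α] {v : ℕ → α} {m : ℕ} (hm : 3 ≤ m)
    (hcard : Fintype.card α = m + 2) (hdist : ∀ i j, i < j → j ≤ i + m → v i ≠ v j)
    (hrep : ∀ i p n, 0 < p → (∀ t < n, v (i + t) = v (i + p + t)) → n * m ≤ p) (t : ℕ) :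
    v (t + m + 3) = v (t + 1) ∨ SwapAt v m (t + 1) ∨ SwapAt v m t := by
  by_cases hC : v (t + m + 2) = v (t + 1)
  · exact Or.inr (Or.inr (swapAt_of_eq hm hcard hdist hrep hC))
  obtain ⟨j, hj1, hj2, hj⟩ := exists_eq_of_distinct (t := t + 1) hcard hdist
    (by rwa [show t + 1 + m + 1 = t + m + 2 by omega]) (v (t + m + 3))
  rcases Nat.lt_or_ge j (t + 3) with h | h
  · obtain rfl | rfl : j = t + 1 ∨ j = t + 2 := by omega
    · exact Or.inl hj.symm
    · refine Or.inr (Or.inl (swapAt_of_eq hm hcard hdist hrep ?_))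
      rw [show t + 1 + m + 2 = t + m + 3 by omega, ← hj]
  · exact (hdist _ _ (by omega) (by omega) hj).elim

theorem not_stay_stay {v : ℕ → α} {m : ℕ} (hm : 3 ≤ m)
    (hrep : ∀ i p n, 0 < p → (∀ t < n, v (i + t) = v (i + p + t)) → n * m ≤ p) {t : ℕ}
    (h0 : v (t + m + 2) = v t) : v (t + m + 3) ≠ v (t + 1) :=
  (not_repeat_pair hm hrep (t := t) (p := m + 2) (by omega) le_rfl h0.symm).symm

theorem SwapAt.isShort {v : ℕ → α} {m t : ℕ} (h : SwapAt v m t) : IsShort v m (v (t + 1)) :=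
  ⟨t + 1, rfl, by rw [← h.1]; congr 1; omega⟩

/-- A swap leaves a window of length m + 2 free of its left letter, while a gap m + 1 puts two
copies in such a window: balance forbids both. -/
theorem SwapAt.not_isShort [DecidableEq α] {v : ℕ → α} (hbal : IsBalanced v) {m : ℕ} (hm : 3 ≤ m)
    (hdist : ∀ i j, i < j → j ≤ i + m → v i ≠ v j)
    (hrep : ∀ i p n, 0 < p → (∀ t < n, v (i + t) = v (i + p + t)) → n * m ≤ p) {t : ℕ}
    (h : SwapAt v m t) : ¬ IsShort v m (v t) := by
  rintro ⟨n, hn, hn'⟩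
  have h0 : (window v (t + 1) (m + 2)).count (v t) = 0 := by
    rw [List.count_eq_zero]
    simp only [window, List.mem_map, List.mem_range, not_exists, not_and]
    intro k hk hk'
    rcases Nat.lt_or_ge k m with hkm | hkm
    · exact hdist t (t + 1 + k) (by omega) (by omega) hk'.symm
    · obtain rfl | rfl : k = m ∨ k = m + 1 := by omega
      · refine not_repeat_pair hm hrep (t := t) (p := k + 1) (by omega) (by omega) ?_ ?_
        · rw [← hk']; congr 1; omega
        · rw [← h.1]; congr 1
      · refine hdist t (t + 1) (by omega) (by omega) ?_
        rw [← hk', ← h.1]; congr 1; omega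
  have h2 : 2 ≤ (window v n (m + 2)).count (v t) := by
    rw [show m + 2 = 1 + m + 1 by omega, window_add, window_add, window_one, window_one,
      List.count_append, List.count_append, hn,
      show n + (1 + m) = n + m + 1 by omega, hn']
    simp
  have := hbal (v t) _ _ (isFactor_window v n (m + 2)) (isFactor_window v (t + 1) (m + 2))
    (by simp [length_window])
  omega

/-- Call a position A if its letter is short, B otherwise. A swap exchanges a B with the A to its
right, and two consecutive positions never both stay. -/
theorem false_of_distinct [Fintype α] [DecidableEq α] {v : ℕ → α} (hbal : IsBalanced v) {m : ℕ}
    (hm : 3 ≤ m) (hcard : Fintype.card α = m + 2)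
    (hdist : ∀ i j, i < j → j ≤ i + m → v i ≠ v j)
    (hrep : ∀ i p n, 0 < p → (∀ t < n, v (i + t) = v (i + p + t)) → n * m ≤ p)
    (hprog : ∀ r P y, 0 < P → (∀ j : ℕ, v (r + j * P) = y) → False) : False := by
  set a : ℕ → Prop := fun t => IsShort v m (v t) with ha
  have tri := stay_or_swapAt hm hcard hdist hrep
  have single : ∀ t, v (t + m + 2) = v t → v (t + m + 3) ≠ v (t + 1) :=
    fun t => not_stay_stay hm hrep
  have sw1 : ∀ {t}, SwapAt v m t → a (t + 1) := fun h => h.isShort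
  have sw0 : ∀ {t}, SwapAt v m t → ¬ a t := fun h => h.not_isShort hbal hm hdist hrep
  -- The second A of an AA must stay, so the next two positions swap; AA reappears m + 3 later.
  have hAA : ∀ t, a t → a (t + 1) →
      ¬ a (t + 2) ∧ a (t + 3) ∧ a (t + m + 3) ∧ a (t + m + 4) := by
    intro t h0 h1
    have hs : v (t + m + 3) = v (t + 1) := by
      rcases tri t with h | h | h
      · exact h
      · exact (sw0 h h1).elim
      · exact (sw0 h h0).elim
    have hsw : SwapAt v m (t + 2) := by
      rcases tri (t + 1) with h | h | h
      · refine (single (t + 1) ?_ ?_).elim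
        · rw [← hs]; congr 1; omega
        · exact h
      · exact h
      · exact (sw0 h h1).elim
    refine ⟨sw0 hsw, sw1 hsw, ?_, ?_⟩
    · simp only [ha]; rw [hs]; exact h1
    · have := sw1 hsw
      simp only [ha] at this ⊢
      rw [show t + m + 4 = t + 2 + m + 2 by omega, hsw.1]
      exact this
  -- Here the first B stays, so swaps occur on both sides; BB reappears only m + 1 later.
  have hBB : ∀ t, ¬ a (t + 2) → ¬ a (t + 3) →
      a (t + 4) ∧ ¬ a (t + m + 3) ∧ ¬ a (t + m + 4) := by
    intro t h2 h3
    have hs : v (t + m + 4) = v (t + 2) := by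
      rcases tri (t + 1) with h | h | h
      · rw [show t + m + 4 = t + 1 + m + 3 by omega, h]
      · exact (h3 (sw1 h)).elim
      · exact (h2 (sw1 h)).elim
    have hr : SwapAt v m (t + 3) := by
      rcases tri (t + 2) with h | h | h
      · refine (single (t + 2) ?_ h).elim
        rw [← hs]; congr 1; omega
      · exact h
      · exact (h3 (sw1 h)).elim
    have hl : SwapAt v m t := by
      rcases tri t with h | h | h
      · refine (single (t + 1) ?_ ?_).elim
        · rw [← h]; congr 1; omega
        · rw [← hs]; congr 1; omega
      · exact (h2 (sw1 h)).elim
      · exact h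
    refine ⟨sw1 hr, ?_, ?_⟩
    · have := sw0 hl
      simp only [ha] at this ⊢
      rwa [hl.2]
    · simp only [ha] at h2 ⊢
      rwa [hs]
  -- The two shifts differ by 2, so an AA gains on any BB to its right until they collide.
  have clash : ∀ k s, a s → a (s + 1) → 2 ≤ s + k → 0 < k → ¬ a (s + k) →
      ¬ a (s + k + 1) → False := by
    intro k
    induction k using Nat.strong_induction_on with
    | _ k ih =>
      intro s h0 h1 hsk hk hk0 hk1
      obtain ⟨g2, g3, g4, g5⟩ := hAA s h0 h1
      obtain ⟨t, ht⟩ := Nat.exists_eq_add_of_le' hsk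
      rw [ht] at hk0 hk1
      obtain ⟨b4, b5, b6⟩ := hBB t hk0 hk1
      rcases Nat.lt_or_ge k 4 with hk4 | hk4
      · interval_cases k
        · rw [← ht] at hk0; exact hk0 h1
        · obtain rfl : t = s := by omega
          exact hk1 g3
        · rw [← ht] at hk0; exact hk0 g3
      · refine ih (k - 2) (by omega) (s + m + 3) g4 g5 (by omega) (by omega) ?_ ?_
        · rwa [show s + m + 3 + (k - 2) = t + m + 3 by omega]
        · rwa [show s + m + 3 + (k - 2) + 1 = t + m + 4 by omega]
  have hswap : ∀ t, ∃ s, t ≤ s ∧ SwapAt v m s := by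
    intro t
    rcases tri t with h | h | h
    · rcases tri (t + 1) with h' | h' | h'
      · refine (single (t + 1) ?_ ?_).elim
        · rw [← h]; congr 1; omega
        · rw [← h']
      · exact ⟨_, by omega, h'⟩
      · exact ⟨_, by omega, h'⟩
    · exact ⟨_, by omega, h⟩
    · exact ⟨_, le_rfl, h⟩
  have hBA : ∀ t, ¬ a (t + 1) → a (t + 2) → SwapAt v m (t + 1) := by
    intro t h1 h2
    rcases tri t with h | h | h
    · rcases tri (t + 1) with h' | h' | h'
      · refine (single (t + 1) ?_ ?_).elim
        · rw [← h]; congr 1; omega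
        · rw [← h']
      · exact (sw0 h' h2).elim
      · exact h'
    · exact h
    · exact (h1 (sw1 h)).elim
  -- After an AA there is no BB: every B is followed by an A and jumps by m + 3 forever. Without AA,
  -- every A from position 2 on follows a B and jumps by m + 1 forever.
  by_cases hex : ∃ s, a s ∧ a (s + 1)
  · obtain ⟨s, h0, h1⟩ := hex
    have hnBB : ∀ t, s < t → 2 ≤ t → ¬ a t → a (t + 1) := by
      intro t hst ht hat
      by_contra hat'
      obtain ⟨k, rfl⟩ := Nat.exists_eq_add_of_le hst.le
      exact clash k s h0 h1 ht (by omega) hat hat'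
    obtain ⟨r, hr, hsw⟩ := hswap (s + 2)
    have hmain : ∀ j, v (r + j * (m + 3)) = v r := by
      intro j
      induction j with
      | zero => simp
      | succ j ih =>
        have hB : ¬ a (r + j * (m + 3)) := by
          simp only [ha]; rw [ih]; exact sw0 hsw
        obtain ⟨u, hu⟩ : ∃ u, r + j * (m + 3) = u + 1 := ⟨r + j * (m + 3) - 1, by omega⟩
        have hA := hnBB _ (by omega) (by omega) hB
        rw [hu] at hB hA ih
        have := (hBA u hB hA).2
        rw [Nat.succ_mul, ← add_assoc, hu, ← ih, ← this]
        congr 1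
    exact hprog r (m + 3) _ (by omega) hmain
  · push Not at hex
    obtain ⟨r, hr, hsw⟩ := hswap 1
    have hmain : ∀ j, v (r + 1 + j * (m + 1)) = v (r + 1) := by
      intro j
      induction j with
      | zero => simp
      | succ j ih =>
        have hA : a (r + 1 + j * (m + 1)) := by
          simp only [ha]; rw [ih]; exact sw1 hsw
        obtain ⟨u, hu⟩ : ∃ u, r + 1 + j * (m + 1) = u + 2 := ⟨r + 1 + j * (m + 1) - 2, by omega⟩
        rw [hu] at hA ih
        have hB : ¬ a (u + 1) := fun h => hex _ h hA
        have := (hBA u hB hA).1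
        rw [Nat.succ_mul, ← add_assoc, hu, ← ih, ← this]
        congr 1; omega
    exact hprog (r + 1) (m + 1) _ (by omega) hmain

end InfWord
-- From gaps to frequencies, and the conclusion.
namespace InfWord

variable {α : Type*}

theorem nodup_window {v : ℕ → α} {m : ℕ} (h : ∀ i j, i < j → j < i + m → v i ≠ v j) (i : ℕ) :
    (window v i m).Nodup := by
  refine List.Nodup.map_on ?_ List.nodup_range
  intro x hx y hy hxy
  rw [List.mem_range] at hx hy
  by_contra hne
  rcases Nat.lt_or_gt_of_ne hne with h' | h'
  · exact h _ _ (by omega) (by omega) hxy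
  · exact h _ _ (by omega) (by omega) hxy.symm

/-- One window of length m + 1 holds the letter twice, so by balance all such windows hold it at
least once. -/
theorem one_div_le_freq_of_gap [DecidableEq α] {v : ℕ → α} (hbal : IsBalanced v) {m i : ℕ}
    (hm : 0 < m) (h : v (i + m) = v i) {θ : ℝ} (hθ : HasLetterFreq v (v i) θ) :
    1 / ((m : ℝ) + 1) ≤ θ := by
  have h2 : 2 ≤ (window v i (m + 1)).count (v i) := by
    obtain ⟨k, rfl⟩ : ∃ k, m = 1 + k := ⟨m - 1, by omega⟩
    rw [window_add, window_add, window_one, window_one, List.count_append, List.count_append, h]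
    simp
  have := hθ.le_of_le_count (c := 1) hbal (Nat.succ_pos m) fun j => by
    have := hbal (v i) _ _ (isFactor_window v i (m + 1)) (isFactor_window v j (m + 1))
      (by simp [length_window])
    show 1 ≤ List.count (v i) (window v j (m + 1))
    omega
  simpa using this

end InfWord

theorem proposition3p4 {α : Type*} [Fintype α] [DecidableEq α] (d : ℕ) (hd : 11 ≤ d)
    (hcard : Fintype.card α = d) (v : ℕ → α) (hbal : InfWord.IsBalanced v)
    (hE : InfWord.critExp v = ((((d : ℝ) - 1) / ((d : ℝ) - 2) : ℝ) : EReal)) :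
    ∃ freq : α → ℝ, (∀ a, InfWord.HasLetterFreq v a (freq a)) ∧
      ∃ ρ : ℝ, IsGreatest (Set.range freq) ρ ∧
        1 / ((d : ℝ) - 1) < ρ ∧ ρ < 1 / ((d : ℝ) - 2) := by
  obtain ⟨m, rfl⟩ : ∃ m, d = m + 2 := ⟨d - 2, by omega⟩
  have hrep : ∀ i p n, 0 < p → (∀ t < n, v (i + t) = v (i + p + t)) → n * m ≤ p :=
    fun i p n hp h => InfWord.mul_le_of_repetition (d := m + 2) (by omega) hE.le hp h
  have hnear : ∀ i j, i < j → j < i + m → v i ≠ v j := by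
    intro i j hij hj h
    have := hrep i (j - i) 1 (by omega) (fun t ht => by
      obtain rfl : t = 0 := by omega
      rw [show i + (j - i) + 0 = j by omega]; exact h)
    omega
  choose freq hfreq using InfWord.exists_hasLetterFreq hbal
  have : Nonempty α := ⟨v 0⟩
  obtain ⟨a, ha⟩ := Finite.exists_max freq
  have hle : freq a ≤ 1 / (m : ℝ) := by
    have := (hfreq a).le_of_count_le (c := 1) hbal (n := m) (by omega) fun i =>
      List.nodup_iff_count_le_one.mp (InfWord.nodup_window hnear i) a
    simpa using this
  have hge : 1 / ((m : ℝ) + 1) ≤ freq a := by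
    by_contra! hlt
    refine InfWord.false_of_distinct hbal (m := m) (by omega) hcard ?_ hrep
      fun r P y hP h => InfWord.not_const_on_progression hbal (by omega) hE.le hP h
    intro i j hij hj h
    rcases Nat.lt_or_ge j (i + m) with h' | h'
    · exact hnear i j hij h' h
    · obtain rfl : j = i + m := by omega
      have := InfWord.one_div_le_freq_of_gap hbal (by omega) h.symm (hfreq (v i))
      linarith [ha (v i)]
  have hirr : Irrational (freq a) :=
    (hfreq a).irrational hbal (by omega) hE.le (lt_of_lt_of_le (by positivity) hge)
  refine ⟨freq, hfreq, freq a, ⟨⟨a, rfl⟩, ?_⟩, ?_, ?_⟩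
  · rintro _ ⟨b, rfl⟩
    exact ha b
  · rw [show (((m + 2 : ℕ) : ℝ) - 1) = m + 1 by push_cast; ring]
    refine lt_of_le_of_ne hge fun h => (Rat.not_irrational (1 / ((m : ℚ) + 1))) ?_
    push_cast
    rwa [h]
  · rw [show (((m + 2 : ℕ) : ℝ) - 2) = m by push_cast; ring]
    refine lt_of_le_of_ne hle fun h => (Rat.not_irrational (1 / (m : ℚ))) ?_
    push_cast
    rwa [← h]
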